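/- Let $X=\{X(t),t\in\mathbb{Z}\}$ be a real-valued stochastic process that is (strictly) stationary and max-infinitely divisible, i.e. for every $n\ge 1$ the process $X$ has the same law as the componentwise maximum of $n$ independent identically distributed real-valued processes indexed by $\mathbb{Z}$. Let $l=\operatorname{ess\,inf} X(0)\in[-\infty,\infty)$ and, for real $a>l$ and $t\in\mathbb{Z}$, let $$\tau_a(t)=\log P[X(0)\le a,\,X(t)\le a]-\log P[X(0)\le a]-\log P[X(t)\le a].$$ Then the following conditions are equivalent: 1. $X$ is mixing: for all measurable $A,B\subseteq\mathbb{R}^{\mathbb{Z}}$ (product $\sigma$-algebra), $\lim_{t\to\infty}P[X\in A,\ X(\cdot+t)\in B]=P[X\in A]\,P[X\in B]$. 2. $X$ is mixing of all orders: for every $r\ge 1$ and all measurable $A_0,\dots,A_r\subseteq\mathbb{R}^{\mathbb{Z}}$, $$\lim_{t_1,\dots,t_r\to+\infty}P\big[X(\cdot+t_1+\dots+t_j)\in A_j\text{ for } j=0,\dots,r\big]=\prod_{j=0}^r P[X\in A_j],$$ where the empty sum (for $j=0$) is $0$. 3. For every real $a>l$, $\lim_{t\to\infty}\tau_a(t)=0$.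 -/

import Mathlib

open MeasureTheory Filter Topology

namespace MaxID

noncomputable section

variable {Ω : Type*} [MeasurableSpace Ω]

/-- The sample path of the process `X`, started at time `t`: the function `s ↦ X (s + t) ω`.
For `t = 0` this is the path of `X` itself; in general it is the path moved by the `t`-th power
of the time shift. -/
def path (X : ℤ → Ω → ℝ) (t : ℤ) (ω : Ω) : ℤ → ℝ := fun s => X (s + t) ω

/-- `X` is (strictly) stationary: the law of the path, on the product σ-algebra of `ℤ → ℝ`, is
invariant under time shifts. -/
def IsStationary (X : ℤ → Ω → ℝ) (P : Measure Ω) : Prop :=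
  ∀ t : ℤ, P.map (path X t) = P.map (path X 0)

/-- `X` is max-infinitely divisible: for every `n ≥ 1` it has the law of the componentwise maximum
of `n` independent processes with a common law `ν`. -/
def IsMaxInfinitelyDivisible (X : ℤ → Ω → ℝ) (P : Measure Ω) : Prop :=
  ∀ n : ℕ, 1 ≤ n → ∃ ν : Measure (ℤ → ℝ), IsProbabilityMeasure ν ∧
    P.map (path X 0) =
      (Measure.pi (fun _ : Fin n => ν)).map (fun Y (s : ℤ) => ⨆ i : Fin n, Y i s)

/-- The essential infimum `l ∈ [-∞, ∞)` of `X 0`. -/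
def lowerEndpoint (X : ℤ → Ω → ℝ) (P : Measure Ω) : EReal :=
  essInf (fun ω => (X 0 ω : EReal)) P

/-- The dependence coefficient `τ_a(t)`. -/
def tau (X : ℤ → Ω → ℝ) (P : Measure Ω) (a : ℝ) (t : ℤ) : ℝ :=
  Real.log (P.real {ω | X 0 ω ≤ a ∧ X t ω ≤ a})
    - Real.log (P.real {ω | X 0 ω ≤ a}) - Real.log (P.real {ω | X t ω ≤ a})

/-- `X` is mixing: `P[X ∈ A, X(· + t) ∈ B] → P[X ∈ A] P[X ∈ B]` as `t → ∞`, for all measurable sets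
of paths `A` and `B`. -/
def IsMixing (X : ℤ → Ω → ℝ) (P : Measure Ω) : Prop :=
  ∀ A B : Set (ℤ → ℝ), MeasurableSet A → MeasurableSet B →
    Tendsto (fun t : ℤ => P.real (path X 0 ⁻¹' A ∩ path X t ⁻¹' B)) atTop
      (𝓝 (P.real (path X 0 ⁻¹' A) * P.real (path X 0 ⁻¹' B)))

/-- `X` is mixing of order `r`: for all measurable sets of paths `A 0, …, A r`, the probability that
`X(· + t₁ + ⋯ + t_j) ∈ A j` for all `j = 0, …, r` tends to `∏ j, P[X ∈ A j]` as `t₁, …, t_r → ∞`.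
(`t₁, …, t_r` are `t 0, …, t (r - 1)` below.) -/
def IsMixingOfOrder (X : ℤ → Ω → ℝ) (P : Measure Ω) (r : ℕ) : Prop :=
  ∀ A : Fin (r + 1) → Set (ℤ → ℝ), (∀ j, MeasurableSet (A j)) →
    Tendsto
      (fun t : Fin r → ℤ =>
        P.real (⋂ j : Fin (r + 1), path X (∑ i : Fin r with i.castSucc < j, t i) ⁻¹' A j))
      (Filter.pi fun _ => atTop)
      (𝓝 (∏ j : Fin (r + 1), P.real (path X 0 ⁻¹' A j)))

/-- `X` is mixing of all orders. -/
def IsMixingOfAllOrders (X : ℤ → Ω → ℝ) (P : Measure Ω) : Prop :=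
  ∀ r : ℕ, 1 ≤ r → IsMixingOfOrder X P r

end

end MaxID

/-! ### Boxes: events compatible with componentwise maxima. -/

namespace MaxID

/-! The heart of the proof is 3 ⇒ 2. If `ν n` is the `n`-th max-root of the law `μ`, then `μ A = (ν
n A)^n` on boxes, so `n (1 - ν n A) → -log μ A`. By inclusion-exclusion, `n * ν n (Aᶜ ∩ Bᶜ) → logDep
μ A B` (`HasMaxRoots.exists_tendsto_logDep`). Thus `logDep` is a limit of rescaled measures, a
substitute for the exponent measure, and is nonnegative, monotone and subadditive.

Consequently the log-probability of an intersection of boxes differs from the sum of the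
log-probabilities by at most a sum of pairwise coefficients (`HasMaxRoots.log_biInter_sub_sum_mem`).
For shifted cylinders these reduce to one-level, two-time coefficients, which vanish by stationarity
and condition 3. Exponentiating gives asymptotic independence of cylinders, and
`tendsto_real_iInter_shift_of_piSystem` extends it to all measurable sets.

2 ⇒ 1 is the case `r = 1`; 1 ⇒ 3 applies mixing to `{x | x 0 ≤ a}` and takes logarithms. -/

/-- Measurable sets of paths which contain `x ⊔ y` exactly when they contain `x` and `y`. -/
structure IsMaxBox (A : Set (ℤ → ℝ)) : Prop where
  measurableSet : MeasurableSet A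
  isLowerSet : IsLowerSet A
  supClosed : SupClosed A

theorem IsMaxBox.univ : IsMaxBox Set.univ :=
  ⟨MeasurableSet.univ, isLowerSet_univ, supClosed_univ⟩

theorem IsMaxBox.inter {A B : Set (ℤ → ℝ)} (hA : IsMaxBox A) (hB : IsMaxBox B) :
    IsMaxBox (A ∩ B) :=
  ⟨hA.1.inter hB.1, hA.2.inter hB.2, hA.3.inter hB.3⟩

theorem IsMaxBox.biInter {ι : Type*} {A : ι → Set (ℤ → ℝ)} (s : Finset ι)
    (hA : ∀ i ∈ s, IsMaxBox (A i)) : IsMaxBox (⋂ i ∈ s, A i) := by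
  classical
  induction s using Finset.induction_on with
  | empty => simpa using IsMaxBox.univ
  | insert a s ha ih =>
    rw [Finset.set_biInter_insert]
    exact (hA a (by simp)).inter (ih fun i hi => hA i (by simp [hi]))

theorem isMaxBox_eval {I : Set ℝ} (hI : MeasurableSet I) (hl : IsLowerSet I) (s : ℤ) :
    IsMaxBox {x : ℤ → ℝ | x s ∈ I} := by
  refine ⟨measurable_pi_apply s hI, fun x y hxy hx => hl (hxy s) hx, fun x hx y hy => ?_⟩
  simp only [Set.mem_ofPred_eq, Pi.sup_apply] at *
  rcases le_total (x s) (y s) with h | h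
  · rwa [sup_eq_right.2 h]
  · rwa [sup_eq_left.2 h]

/-- The time shift by `u`. -/
def shift (u : ℤ) (x : ℤ → ℝ) : ℤ → ℝ := fun s => x (s + u)

theorem measurable_shift (u : ℤ) : Measurable (shift u) :=
  measurable_pi_lambda _ fun _ => measurable_pi_apply _

theorem IsMaxBox.shift {A : Set (ℤ → ℝ)} (hA : IsMaxBox A) (u : ℤ) :
    IsMaxBox (shift u ⁻¹' A) :=
  ⟨measurable_shift u hA.1, fun _ _ hxy hx => hA.2 (fun s => hxy (s + u)) hx,
    fun _ hx _ hy => hA.3 hx hy⟩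

/-- This is what turns a maximum of `n` independent copies into an `n`-th power. -/
theorem IsMaxBox.iSup_mem_iff {A : Set (ℤ → ℝ)} (hA : IsMaxBox A) {n : ℕ} (hn : 1 ≤ n)
    (Y : Fin n → ℤ → ℝ) : (fun s => ⨆ i, Y i s) ∈ A ↔ ∀ i, Y i ∈ A := by
  have : Nonempty (Fin n) := ⟨⟨0, hn⟩⟩
  constructor
  · intro h i
    exact hA.2 (fun s => le_ciSup (f := fun i => Y i s) (Set.finite_range _).bddAbove i) h
  · intro h
    have h1 := hA.3.finsetSup'_mem (t := Finset.univ) Finset.univ_nonempty (f := Y)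
      (fun i _ => h i)
    convert h1 using 1
    ext s
    rw [Finset.sup'_apply, Finset.sup'_univ_eq_ciSup]

/-! ### Max-roots of a law and the logarithmic dependence coefficient. -/

/-- `μ` has, for every `n ≥ 1`, an `n`-th root on the boxes. -/
def HasMaxRoots (μ : Measure (ℤ → ℝ)) : Prop :=
  ∀ n : ℕ, 1 ≤ n → ∃ ν : Measure (ℤ → ℝ), IsProbabilityMeasure ν ∧
    ∀ A, IsMaxBox A → μ.real A = ν.real A ^ n

theorem IsMaxInfinitelyDivisible.hasMaxRoots {Ω : Type*} [MeasurableSpace Ω] {P : Measure Ω}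
    {X : ℤ → Ω → ℝ} (h : IsMaxInfinitelyDivisible X P) : HasMaxRoots (P.map (path X 0)) := by
  intro n hn
  obtain ⟨ν, hν, he⟩ := h n hn
  refine ⟨ν, hν, fun A hA => ?_⟩
  have hm : Measurable (fun (Y : Fin n → ℤ → ℝ) (s : ℤ) => ⨆ i : Fin n, Y i s) :=
    measurable_pi_lambda _ fun s => Measurable.iSup fun i => by fun_prop
  rw [he, map_measureReal_apply hm hA.1]
  have : (fun (Y : Fin n → ℤ → ℝ) (s : ℤ) => ⨆ i : Fin n, Y i s) ⁻¹' A
      = Set.univ.pi fun _ => A := by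
    ext Y
    simp [hA.iSup_mem_iff hn]
  rw [this]
  simp [Measure.real, Measure.pi_pi]

/-- Here `y n = exp (log p / n)`, so the limit is minus the derivative of `exp (t log p)` at `t =
0`, sampled at `t = 1 / n`. -/
theorem tendsto_mul_one_sub_of_pow_eq {p : ℝ} (hp : 0 < p) {y : ℕ → ℝ} (hy : ∀ n, 0 ≤ y n)
    (h : ∀ n, 1 ≤ n → p = y n ^ n) :
    Tendsto (fun n : ℕ => n * (1 - y n)) atTop (𝓝 (-Real.log p)) := by
  set c := Real.log p
  have h1 : Tendsto (fun t : ℝ => t⁻¹ * (Real.exp (c * t) - 1)) (𝓝[≠] 0) (𝓝 c) := by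
    have : HasDerivAt (fun t : ℝ => Real.exp (c * t)) c 0 := by
      simpa using ((hasDerivAt_id (0 : ℝ)).const_mul c).exp
    simpa using this.tendsto_slope_zero
  have h2 : Tendsto (fun n : ℕ => (n : ℝ)⁻¹) atTop (𝓝[≠] 0) :=
    tendsto_nhdsWithin_iff.2 ⟨tendsto_inv_atTop_nhds_zero_nat,
      (eventually_ge_atTop 1).mono fun n hn => by
        have : n ≠ 0 := by omega
        simpa using this⟩
  refine ((h1.comp h2).neg).congr' ((eventually_ge_atTop 1).mono fun n hn => ?_)
  have hn0 : (n : ℝ) ≠ 0 := by positivity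
  have hyn : 0 < y n := (hy n).lt_of_ne fun h0 => by
    have := h n hn
    rw [← h0, zero_pow (by omega)] at this
    exact hp.ne' this
  have : Real.exp (c * (n : ℝ)⁻¹) = y n := by
    have : c = n * Real.log (y n) := by
      rw [← Real.log_pow, ← h n hn]
    rw [this, mul_comm, inv_mul_cancel_left₀ hn0, Real.exp_log hyn]
  simp only [Function.comp_apply, inv_inv, this]
  ring

/-- The logarithmic dependence coefficient of two events. -/
noncomputable def logDep (μ : Measure (ℤ → ℝ)) (A B : Set (ℤ → ℝ)) : ℝ :=
  Real.log (μ.real (A ∩ B)) - Real.log (μ.real A) - Real.log (μ.real B)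

theorem logDep_comm (μ : Measure (ℤ → ℝ)) (A B : Set (ℤ → ℝ)) : logDep μ A B = logDep μ B A := by
  rw [logDep, logDep, Set.inter_comm]; ring

theorem real_compl_inter_compl (ν : Measure (ℤ → ℝ)) [IsProbabilityMeasure ν]
    {A B : Set (ℤ → ℝ)} (hA : MeasurableSet A) (hB : MeasurableSet B) :
    ν.real (Aᶜ ∩ Bᶜ) = (1 - ν.real A) + (1 - ν.real B) - (1 - ν.real (A ∩ B)) := by
  have h := measureReal_union_add_inter (μ := ν) (s := A) hB
  rw [← Set.compl_union, probReal_compl_eq_one_sub (hA.union hB)]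
  linarith

section Roots

variable {μ : Measure (ℤ → ℝ)}

theorem HasMaxRoots.exists_seq (hμ : HasMaxRoots μ) :
    ∃ ν : ℕ → Measure (ℤ → ℝ), (∀ n, IsProbabilityMeasure (ν n)) ∧
      ∀ n, 1 ≤ n → ∀ A, IsMaxBox A → μ.real A = (ν n).real A ^ n := by
  have key : ∀ n, ∃ ν : Measure (ℤ → ℝ), IsProbabilityMeasure ν ∧
      (1 ≤ n → ∀ A, IsMaxBox A → μ.real A = ν.real A ^ n) := fun n => by
    rcases Nat.eq_zero_or_pos n with rfl | hn
    · exact ⟨Measure.dirac 0, inferInstance, by simp⟩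
    · obtain ⟨ν, h, h'⟩ := hμ n hn
      exact ⟨ν, h, fun _ => h'⟩
  choose ν hν h using key
  exact ⟨ν, hν, h⟩

/-- The complements of `A` and `B` have `ν n`-mass `O(1 / n)`, so for large `n` they cannot cover
the space. Positivity keeps `Real.log` away from its default value at `0`. -/
theorem HasMaxRoots.inter_pos (hμ : HasMaxRoots μ) {A B : Set (ℤ → ℝ)} (hA : IsMaxBox A)
    (hB : IsMaxBox B) (hA0 : 0 < μ.real A) (hB0 : 0 < μ.real B) : 0 < μ.real (A ∩ B) := by
  obtain ⟨ν, hν, h⟩ := hμ.exists_seq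
  have ha := tendsto_mul_one_sub_of_pow_eq hA0 (fun n => measureReal_nonneg (μ := ν n))
    fun n hn => h n hn A hA
  have hb := tendsto_mul_one_sub_of_pow_eq hB0 (fun n => measureReal_nonneg (μ := ν n))
    fun n hn => h n hn B hB
  have hsum := ((ha.add hb).mul tendsto_inv_atTop_nhds_zero_nat)
  rw [mul_zero] at hsum
  obtain ⟨n, hn1, hn⟩ := ((hsum.eventually_lt_const one_pos).and (eventually_ge_atTop 1)).exists
  have hn0 : (n : ℝ) ≠ 0 := by positivity
  rw [← mul_add, mul_comm, inv_mul_cancel_left₀ hn0] at hn1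
  have hc := real_compl_inter_compl (ν n) hA.1 hB.1
  have : 0 < (ν n).real (A ∩ B) := by
    have : 0 ≤ (ν n).real (Aᶜ ∩ Bᶜ) := measureReal_nonneg
    linarith
  rw [h n hn _ (hA.inter hB)]
  positivity

/-- The sequence `ν` is the same for all pairs of boxes, so inequalities between measures of sets
pass to `logDep` in the limit. -/
theorem HasMaxRoots.exists_tendsto_logDep (hμ : HasMaxRoots μ) :
    ∃ ν : ℕ → Measure (ℤ → ℝ), (∀ n, IsProbabilityMeasure (ν n)) ∧
      ∀ A B, IsMaxBox A → IsMaxBox B → 0 < μ.real A → 0 < μ.real B →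
        Tendsto (fun n : ℕ => n * (ν n).real (Aᶜ ∩ Bᶜ)) atTop (𝓝 (logDep μ A B)) := by
  obtain ⟨ν, hν, h⟩ := hμ.exists_seq
  refine ⟨ν, hν, fun A B hA hB hA0 hB0 => ?_⟩
  have ht : ∀ C, IsMaxBox C → 0 < μ.real C →
      Tendsto (fun n : ℕ => n * (1 - (ν n).real C)) atTop (𝓝 (-Real.log (μ.real C))) :=
    fun C hC hC0 => tendsto_mul_one_sub_of_pow_eq hC0 (fun n => measureReal_nonneg)
      fun n hn => h n hn C hC
  have := ((ht A hA hA0).add (ht B hB hB0)).sub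
    (ht _ (hA.inter hB) (hμ.inter_pos hA hB hA0 hB0))
  convert this using 1
  · ext n
    rw [real_compl_inter_compl (ν n) hA.1 hB.1]; ring
  · rw [logDep]; congr 1; ring

theorem HasMaxRoots.logDep_nonneg (hμ : HasMaxRoots μ) {A B : Set (ℤ → ℝ)} (hA : IsMaxBox A)
    (hB : IsMaxBox B) (hA0 : 0 < μ.real A) (hB0 : 0 < μ.real B) : 0 ≤ logDep μ A B := by
  obtain ⟨ν, hν, h⟩ := hμ.exists_tendsto_logDep
  exact ge_of_tendsto' (h A B hA hB hA0 hB0) fun n => by positivity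

theorem HasMaxRoots.logDep_anti (hμ : HasMaxRoots μ) [IsFiniteMeasure μ] {A B A' B' : Set (ℤ → ℝ)}
    (hA : IsMaxBox A) (hB : IsMaxBox B) (hA' : IsMaxBox A') (hB' : IsMaxBox B')
    (hA0 : 0 < μ.real A') (hB0 : 0 < μ.real B') (hAA : A' ⊆ A) (hBB : B' ⊆ B) :
    logDep μ A B ≤ logDep μ A' B' := by
  obtain ⟨ν, hν, h⟩ := hμ.exists_tendsto_logDep
  refine le_of_tendsto_of_tendsto'
    (h A B hA hB (hA0.trans_le (measureReal_mono hAA)) (hB0.trans_le (measureReal_mono hBB)))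
    (h A' B' hA' hB' hA0 hB0) fun n => ?_
  gcongr
  exact measure_ne_top _ _

theorem HasMaxRoots.logDep_inter_le (hμ : HasMaxRoots μ) {A B C : Set (ℤ → ℝ)}
    (hA : IsMaxBox A) (hB : IsMaxBox B) (hC : IsMaxBox C)
    (hA0 : 0 < μ.real A) (hB0 : 0 < μ.real B) (hC0 : 0 < μ.real C) :
    logDep μ (A ∩ B) C ≤ logDep μ A C + logDep μ B C := by
  obtain ⟨ν, hν, h⟩ := hμ.exists_tendsto_logDep
  refine le_of_tendsto_of_tendsto'
    (h (A ∩ B) C (hA.inter hB) hC (hμ.inter_pos hA hB hA0 hB0) hC0)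
    ((h A C hA hC hA0 hC0).add (h B C hB hC hB0 hC0)) fun n => ?_
  rw [← mul_add, Set.compl_inter, Set.union_inter_distrib_right]
  gcongr
  exact measureReal_union_le _ _

variable [IsProbabilityMeasure μ] {ι : Type*}

theorem HasMaxRoots.biInter_pos (hμ : HasMaxRoots μ) {A : ι → Set (ℤ → ℝ)} (s : Finset ι)
    (hA : ∀ i ∈ s, IsMaxBox (A i)) (hA0 : ∀ i ∈ s, 0 < μ.real (A i)) :
    0 < μ.real (⋂ i ∈ s, A i) := by
  classical
  induction s using Finset.induction_on with
  | empty => simp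
  | insert a s ha ih =>
    rw [Finset.set_biInter_insert]
    rw [Finset.forall_mem_insert] at hA hA0
    exact hμ.inter_pos hA.1 (IsMaxBox.biInter s hA.2) hA0.1 (ih hA.2 hA0.2)

theorem HasMaxRoots.logDep_biInter_le (hμ : HasMaxRoots μ) {A : ι → Set (ℤ → ℝ)}
    {B : Set (ℤ → ℝ)} (s : Finset ι) (hA : ∀ i ∈ s, IsMaxBox (A i))
    (hA0 : ∀ i ∈ s, 0 < μ.real (A i)) (hB : IsMaxBox B) (hB0 : 0 < μ.real B) :
    logDep μ (⋂ i ∈ s, A i) B ≤ ∑ i ∈ s, logDep μ (A i) B := by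
  classical
  induction s using Finset.induction_on with
  | empty => simp [logDep]
  | insert a s ha ih =>
    rw [Finset.set_biInter_insert, Finset.sum_insert ha]
    rw [Finset.forall_mem_insert] at hA hA0
    exact (hμ.logDep_inter_le hA.1 (IsMaxBox.biInter s hA.2) hB hA0.1
      (hμ.biInter_pos s hA.2 hA0.2) hB0).trans (by gcongr; exact ih hA.2 hA0.2)

/-- Adding a box to the intersection changes the difference by exactly one `logDep`, which is
nonnegative and subadditive. `offDiag` counts each pair twice; the surplus is nonnegative. -/
theorem HasMaxRoots.log_biInter_sub_sum_mem (hμ : HasMaxRoots μ) [DecidableEq ι]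
    {A : ι → Set (ℤ → ℝ)} (s : Finset ι) (hA : ∀ i ∈ s, IsMaxBox (A i))
    (hA0 : ∀ i ∈ s, 0 < μ.real (A i)) :
    Real.log (μ.real (⋂ i ∈ s, A i)) - ∑ i ∈ s, Real.log (μ.real (A i)) ∈
      Set.Icc 0 (∑ p ∈ s.offDiag, logDep μ (A p.1) (A p.2)) := by
  induction s using Finset.induction_on with
  | empty => simp
  | insert a s ha ih =>
    rw [Finset.set_biInter_insert, Finset.sum_insert ha, Finset.offDiag_insert ha]
    rw [Finset.forall_mem_insert] at hA hA0
    obtain ⟨h1, h2⟩ := ih hA.2 hA0.2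
    have hb := IsMaxBox.biInter s hA.2
    have hb0 := hμ.biInter_pos s hA.2 hA0.2
    have h3 := hμ.logDep_nonneg hb hA.1 hb0 hA0.1
    have h4 := hμ.logDep_biInter_le s hA.2 hA0.2 hA.1 hA0.1
    have h5 : ∑ i ∈ s, logDep μ (A i) (A a) = ∑ p ∈ s ×ˢ {a}, logDep μ (A p.1) (A p.2) := by
      rw [Finset.sum_product]; simp
    have h6 : 0 ≤ ∑ p ∈ {a} ×ˢ s, logDep μ (A p.1) (A p.2) := by
      refine Finset.sum_nonneg fun p hp => ?_
      simp only [Finset.mem_product, Finset.mem_singleton] at hp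
      rw [hp.1]
      exact hμ.logDep_nonneg hA.1 (hA.2 _ hp.2) hA0.1 (hA0.2 _ hp.2)
    rw [Finset.sum_union, Finset.sum_union]
    · rw [logDep, Set.inter_comm] at h3 h4
      constructor <;> linarith
    · rw [Finset.disjoint_left]
      rintro ⟨i, j⟩ hp hq
      simp only [Finset.mem_offDiag, Finset.mem_product, Finset.mem_singleton] at hp hq
      exact ha (hq.1 ▸ hp.1)
    · rw [Finset.disjoint_left]
      rintro ⟨i, j⟩ hp hq
      simp only [Finset.mem_union, Finset.mem_offDiag, Finset.mem_product,
        Finset.mem_singleton] at hp hq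
      rcases hp with hp | hp
      · exact ha (hq.2 ▸ hp.2.1)
      · exact ha (hp.1 ▸ hq.1)

end Roots

/-! ### Extension from a π-system to all measurable events. -/

/-- If the joint probability of shifted events is asymptotically a product for events in a
generating π-system, then it is so for all events. -/
theorem tendsto_real_iInter_shift_of_piSystem {ι α : Type*} [Fintype ι] {μ : Measure (ℤ → ℝ)}
    [IsProbabilityMeasure μ] (hinv : ∀ u, MeasurePreserving (shift u) μ μ)
    {l : Filter α} (u : ι → α → ℤ) {C : Set (Set (ℤ → ℝ))}
    (hgen : MeasurableSpace.pi = MeasurableSpace.generateFrom C) (hpi : IsPiSystem C)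
    (huniv : Set.univ ∈ C)
    (hC : ∀ A : ι → Set (ℤ → ℝ), (∀ j, A j ∈ C) →
      Tendsto (fun t => μ.real (⋂ j, shift (u j t) ⁻¹' A j)) l (𝓝 (∏ j, μ.real (A j))))
    (A : ι → Set (ℤ → ℝ)) (hA : ∀ j, MeasurableSet (A j)) :
    Tendsto (fun t => μ.real (⋂ j, shift (u j t) ⁻¹' A j)) l (𝓝 (∏ j, μ.real (A j))) := by
  classical
  -- Coordinates are freed from `C` one at a time: those in `s` already carry arbitrary measurable
  -- sets.
  suffices H : ∀ (s : Finset ι) (A : ι → Set (ℤ → ℝ)), (∀ j, MeasurableSet (A j)) →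
      (∀ j ∉ s, A j ∈ C) →
      Tendsto (fun t => μ.real (⋂ j, shift (u j t) ⁻¹' A j)) l (𝓝 (∏ j, μ.real (A j))) from
    H Finset.univ A hA (by simp)
  have hCm : ∀ B ∈ C, MeasurableSet B := fun B hB => by
    rw [hgen]; exact MeasurableSpace.measurableSet_generateFrom hB
  intro s
  induction s using Finset.induction_on with
  | empty => exact fun A _ h => hC A fun j => h j (by simp)
  | insert k s hk ih =>
    intro A hA hAC
    set R : α → Set (ℤ → ℝ) := fun t => ⋂ j, ⋂ (_ : j ≠ k), shift (u j t) ⁻¹' A j with hR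
    have hsplit : ∀ B t, ⋂ j, shift (u j t) ⁻¹' Function.update A k B j
        = shift (u k t) ⁻¹' B ∩ R t := by
      intro B t
      ext x
      simp only [hR, Set.mem_iInter, Set.mem_inter_iff, Set.mem_preimage]
      constructor
      · intro h
        exact ⟨by simpa using h k, fun j hj => by simpa [hj] using h j⟩
      · rintro ⟨h1, h2⟩ j
        rcases eq_or_ne j k with rfl | hj
        · simpa using h1
        · simpa [hj] using h2 j hj
    have hprod : ∀ B, ∏ j, μ.real (Function.update A k B j)
        = μ.real B * ∏ j ∈ Finset.univ.erase k, μ.real (A j) := by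
      intro B
      rw [← Finset.mul_prod_erase _ _ (Finset.mem_univ k), Function.update_self]
      congr 1
      refine Finset.prod_congr rfl fun j hj => ?_
      rw [Function.update_of_ne (Finset.ne_of_mem_erase hj)]
    have hRm : ∀ t, MeasurableSet (R t) := fun t =>
      MeasurableSet.iInter fun j => MeasurableSet.iInter fun _ => measurable_shift _ (hA j)
    set q := ∏ j ∈ Finset.univ.erase k, μ.real (A j)
    have hbase : ∀ B ∈ C, Tendsto (fun t => μ.real (shift (u k t) ⁻¹' B ∩ R t)) l
        (𝓝 (μ.real B * q)) := by
      intro B hB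
      have := ih (Function.update A k B) (fun j => ?_) (fun j hj => ?_)
      · simpa only [hsplit, hprod] using this
      · rcases eq_or_ne j k with rfl | hjk
        · simpa using hCm B hB
        · simpa [hjk] using hA j
      · rcases eq_or_ne j k with rfl | hjk
        · simpa using hB
        · simpa [hjk] using hAC j (by simp [hjk, hj])
    have hall : ∀ B, MeasurableSet B → Tendsto (fun t => μ.real (shift (u k t) ⁻¹' B ∩ R t)) l
        (𝓝 (μ.real B * q)) := by
      intro B hB
      induction B, hB using MeasurableSpace.induction_on_inter hgen hpi with
      | empty => simpa using tendsto_const_nhds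
      | basic B hB => exact hbase B hB
      | compl B hB h =>
        have := (hbase _ huniv).sub h
        rw [probReal_univ, ← sub_mul, ← probReal_compl_eq_one_sub hB] at this
        refine this.congr fun t => ?_
        rw [Set.preimage_univ, Set.univ_inter, Set.preimage_compl,
          ← measureReal_inter_add_sdiff (μ := μ) (s := R t) (measurable_shift (u k t) hB),
          Set.inter_comm (R t), Set.sdiff_eq, Set.inter_comm (R t) _ᶜ]
        ring
      | iUnion f hd hf h =>
        have hsum : ∀ g : ℕ → Set (ℤ → ℝ), Pairwise (Function.onFun Disjoint g) →
            (∀ i, MeasurableSet (g i)) → μ.real (⋃ i, g i) = ∑' i, μ.real (g i) := by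
          intro g hgd hg
          rw [Measure.real, measure_iUnion hgd hg, ENNReal.tsum_toReal_eq]
          · rfl
          · exact fun i => measure_ne_top _ _
        rw [hsum f hd hf, ← tsum_mul_right]
        -- Shift invariance makes the dominating series `μ.real (f i)` independent of `t`.
        have hdom := tendsto_tsum_of_dominated_convergence
          (bound := fun i => μ.real (f i)) (summable_measure_toReal hf hd) h
          (Eventually.of_forall fun t i => by
            rw [Real.norm_of_nonneg measureReal_nonneg, ← (hinv (u k t)).measureReal_preimage
              (hf i).nullMeasurableSet]
            exact measureReal_mono Set.inter_subset_left)
        refine hdom.congr fun t => ?_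
        rw [Set.preimage_iUnion, Set.iUnion_inter, hsum]
        · intro i j hij
          exact ((hd hij).preimage _).mono Set.inter_subset_left Set.inter_subset_left
        · exact fun i => (measurable_shift _ (hf i)).inter (hRm t)
    have := hall (A k) (hA k)
    simp only [← hsplit, ← hprod, Function.update_eq_self] at this
    exact this

/-! ### The generating π-system of cylinders. -/

/-- The paths which are below the level `p.2` at time `p.1` for all `p ∈ F`. -/
def cylinder (F : Finset (ℤ × ℝ)) : Set (ℤ → ℝ) := ⋂ p ∈ F, {x | x p.1 < p.2}

theorem isMaxBox_lt (s : ℤ) (a : ℝ) : IsMaxBox {x | x s < a} :=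
  isMaxBox_eval measurableSet_Iio (isLowerSet_Iio a) s

theorem isMaxBox_le (s : ℤ) (a : ℝ) : IsMaxBox {x | x s ≤ a} :=
  isMaxBox_eval measurableSet_Iic (isLowerSet_Iic a) s

theorem isMaxBox_cylinder (F : Finset (ℤ × ℝ)) : IsMaxBox (cylinder F) :=
  IsMaxBox.biInter F fun _ _ => isMaxBox_lt _ _

theorem univ_mem_range_cylinder : Set.univ ∈ Set.range cylinder := ⟨∅, by simp [cylinder]⟩

theorem isPiSystem_range_cylinder : IsPiSystem (Set.range cylinder) := by
  classical
  rintro _ ⟨F, rfl⟩ _ ⟨G, rfl⟩ -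
  refine ⟨F ∪ G, ?_⟩
  simp only [cylinder, Finset.mem_union, Set.iInter_or, Set.iInter_inter_distrib]

theorem pi_eq_generateFrom_range_cylinder :
    MeasurableSpace.pi = MeasurableSpace.generateFrom (Set.range cylinder) := by
  refine le_antisymm (iSup_le fun s => ?_) (MeasurableSpace.generateFrom_le ?_)
  · rw [← measurable_iff_comap_le]
    refine (borel_eq_generateFrom_Iio ℝ ▸ BorelSpace.measurable_eq (α := ℝ)) ▸
      @measurable_generateFrom _ _ (_) _ _ ?_
    rintro _ ⟨a, rfl⟩
    exact MeasurableSpace.measurableSet_generateFrom ⟨{(s, a)}, by simp [cylinder]; rfl⟩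
  · rintro _ ⟨F, rfl⟩
    exact (isMaxBox_cylinder F).1

/-! ### Asymptotic independence of shifted cylinders. -/

section Stationary

variable {μ : Measure (ℤ → ℝ)}

theorem logDep_shift (hinv : ∀ u, MeasurePreserving (shift u) μ μ) {A B : Set (ℤ → ℝ)}
    (hA : MeasurableSet A) (hB : MeasurableSet B) (u : ℤ) :
    logDep μ (shift u ⁻¹' A) (shift u ⁻¹' B) = logDep μ A B := by
  simp only [logDep, ← Set.preimage_inter]
  rw [(hinv u).measureReal_preimage (hA.inter hB).nullMeasurableSet,
    (hinv u).measureReal_preimage hA.nullMeasurableSet,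
    (hinv u).measureReal_preimage hB.nullMeasurableSet]

variable [IsProbabilityMeasure μ]

/-- This is why cylinders use strict inequalities: an event `{x | x s ≤ a}` may have positive mass
with `a` equal to the lower endpoint, where condition 3 says nothing. -/
theorem exists_lt_real_pos {a : ℝ} {s : ℤ} (h : 0 < μ.real {x | x s < a}) :
    ∃ b < a, 0 < μ.real {x | x s < b} := by
  by_contra! hb
  have hnull : ∀ b < a, μ {x | x s < b} = 0 := fun b hba =>
    (measureReal_eq_zero_iff).1 (le_antisymm (hb b hba) measureReal_nonneg)
  obtain ⟨v, -, hv, hlim⟩ := exists_seq_strictMono_tendsto a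
  refine h.ne' ((measureReal_eq_zero_iff).2 (measure_mono_null (fun x hx => ?_)
    (measure_iUnion_null fun n => hnull (v n) (hv n))))
  obtain ⟨n, hn⟩ := (hlim.eventually_const_lt (show x s < a from hx)).exists
  exact Set.mem_iUnion.2 ⟨n, hn⟩

variable (hμ : HasMaxRoots μ) (hinv : ∀ u, MeasurePreserving (shift u) μ μ)
  (hdep : ∀ b, 0 < μ.real {x | x 0 < b} →
    Tendsto (fun t : ℤ => logDep μ {x | x 0 ≤ b} {x | x t ≤ b}) atTop (𝓝 0))
include hμ hinv hdep

theorem tendsto_logDep_lt {α : Type*} {l : Filter α} {u v : α → ℤ}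
    (huv : Tendsto (fun t => v t - u t) l atTop) {a b : ℝ} (ha : 0 < μ.real {x | x 0 < a})
    (hb : 0 < μ.real {x | x 0 < b}) :
    Tendsto (fun t => logDep μ {x | x (u t) < a} {x | x (v t) < b}) l (𝓝 0) := by
  have hpos : ∀ s c, 0 < μ.real {x | x 0 < c} → 0 < μ.real {x | x s < c} := by
    intro s c hc
    rw [← (hinv s).measureReal_preimage (isMaxBox_lt 0 c).1.nullMeasurableSet] at hc
    simpa [shift] using hc
  -- A common level strictly below both, so that `{≤ c}` lies in `{< a}` and `{< b}` and
  -- monotonicity applies.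
  obtain ⟨c, hc, hc0⟩ := exists_lt_real_pos (a := min a b) (s := (0 : ℤ))
    (by rcases min_choice a b with h | h <;> rwa [h])
  refine squeeze_zero (fun t => ?_) (fun t => ?_) ((hdep c hc0).comp huv)
  · exact hμ.logDep_nonneg (isMaxBox_lt _ _) (isMaxBox_lt _ _) (hpos _ _ ha) (hpos _ _ hb)
  · have hle : ∀ s, 0 < μ.real {x | x s ≤ c} := fun s =>
      (hpos s c hc0).trans_le (measureReal_mono fun x (hx : x s < c) => hx.le)
    refine (hμ.logDep_anti (isMaxBox_lt _ _) (isMaxBox_lt _ _) (isMaxBox_le _ c) (isMaxBox_le _ c)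
      (hle _) (hle _) (fun x hx => lt_of_le_of_lt hx (lt_min_iff.1 hc).1)
      (fun x hx => lt_of_le_of_lt hx (lt_min_iff.1 hc).2)).trans_eq ?_
    rw [Function.comp_apply, ← logDep_shift hinv (isMaxBox_le 0 c).1
      (isMaxBox_le (v t - u t) c).1 (u t)]
    simp [shift]

/-- Subadditivity in each argument bounds the coefficient by a finite double sum over single
constraints. -/
theorem tendsto_logDep_cylinder {α : Type*} {l : Filter α} {u v : α → ℤ}
    (huv : Tendsto (fun t => v t - u t) l atTop) {F G : Finset (ℤ × ℝ)}
    (hF : 0 < μ.real (cylinder F)) (hG : 0 < μ.real (cylinder G)) :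
    Tendsto (fun t => logDep μ (shift (u t) ⁻¹' cylinder F) (shift (v t) ⁻¹' cylinder G)) l
      (𝓝 0) := by
  have hbox : ∀ (u : ℤ) (p : ℤ × ℝ), IsMaxBox (shift u ⁻¹' {x | x p.1 < p.2}) := fun u p =>
    (isMaxBox_lt _ _).shift u
  have hcyl : ∀ u (F : Finset (ℤ × ℝ)), shift u ⁻¹' cylinder F
      = ⋂ p ∈ F, shift u ⁻¹' {x | x p.1 < p.2} := fun u F => by
    simp only [cylinder, Set.preimage_iInter]
  have hcpos : ∀ u (F : Finset (ℤ × ℝ)), 0 < μ.real (cylinder F) →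
      0 < μ.real (shift u ⁻¹' cylinder F) := fun u F h => by
    rwa [(hinv u).measureReal_preimage (isMaxBox_cylinder F).1.nullMeasurableSet]
  have hpos : ∀ u (F : Finset (ℤ × ℝ)), 0 < μ.real (cylinder F) → ∀ p ∈ F,
      0 < μ.real (shift u ⁻¹' {x | x p.1 < p.2}) := fun u F h p hp =>
    (hcpos u F h).trans_le (measureReal_mono (Set.preimage_mono (Set.biInter_subset_of_mem hp)))
  have hpos0 : ∀ (F : Finset (ℤ × ℝ)), 0 < μ.real (cylinder F) → ∀ p ∈ F,
      0 < μ.real {x | x 0 < p.2} := fun F h p hp => by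
    simpa [shift] using hpos (-p.1) F h p hp
  have hlim : Tendsto (fun t => ∑ p ∈ F, ∑ q ∈ G, logDep μ (shift (u t) ⁻¹' {x | x p.1 < p.2})
      (shift (v t) ⁻¹' {x | x q.1 < q.2})) l (𝓝 (∑ p ∈ F, ∑ q ∈ G, 0)) := by
    refine tendsto_finsetSum _ fun p hp => tendsto_finsetSum _ fun q hq => ?_
    refine tendsto_logDep_lt hμ hinv hdep (u := fun t => p.1 + u t) (v := fun t => q.1 + v t) ?_
      (hpos0 F hF p hp) (hpos0 G hG q hq)
    refine (tendsto_atTop_add_const_right l (q.1 - p.1) huv).congr fun t => by ring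
  simp only [Finset.sum_const_zero] at hlim
  refine squeeze_zero (fun t => ?_) (fun t => ?_) hlim
  · exact hμ.logDep_nonneg ((isMaxBox_cylinder F).shift _) ((isMaxBox_cylinder G).shift _)
      (hcpos _ F hF) (hcpos _ G hG)
  · have hGpos := hcpos (v t) G hG
    have hGbox := (isMaxBox_cylinder G).shift (v t)
    rw [hcyl _ F]
    refine (hμ.logDep_biInter_le F (fun p _ => hbox _ p) (hpos _ F hF) hGbox hGpos).trans
      (Finset.sum_le_sum fun p hp => ?_)
    rw [logDep_comm, hcyl]
    refine (hμ.logDep_biInter_le G (fun p _ => hbox _ p) (hpos _ G hG) (hbox _ p)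
      (hpos _ F hF p hp)).trans_eq (Finset.sum_congr rfl fun q _ => logDep_comm _ _ _)

theorem tendsto_real_iInter_shift_cylinder {ι α : Type*} [Fintype ι] [LinearOrder ι]
    {l : Filter α} {u : ι → α → ℤ} (hu : ∀ j k, j < k → Tendsto (fun t => u k t - u j t) l atTop)
    (F : ι → Finset (ℤ × ℝ)) :
    Tendsto (fun t => μ.real (⋂ j, shift (u j t) ⁻¹' cylinder (F j))) l
      (𝓝 (∏ j, μ.real (cylinder (F j)))) := by
  have hsh : ∀ u (F : Finset (ℤ × ℝ)), μ.real (shift u ⁻¹' cylinder F) = μ.real (cylinder F) :=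
    fun u F => (hinv u).measureReal_preimage (isMaxBox_cylinder F).1.nullMeasurableSet
  -- A null factor makes both sides vanish; otherwise logarithms are legitimate.
  by_cases h0 : ∃ j, μ.real (cylinder (F j)) = 0
  · obtain ⟨j, hj⟩ := h0
    rw [Finset.prod_eq_zero (Finset.mem_univ j) hj]
    refine tendsto_const_nhds.congr fun t => (le_antisymm ?_ measureReal_nonneg).symm
    rw [← hj, ← hsh (u j t)]
    exact measureReal_mono (Set.iInter_subset _ j)
  push Not at h0
  have hpos : ∀ j, 0 < μ.real (cylinder (F j)) := fun j => measureReal_nonneg.lt_of_ne (h0 j).symm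
  have hbox : ∀ j t, IsMaxBox (shift (u j t) ⁻¹' cylinder (F j)) := fun j t =>
    (isMaxBox_cylinder _).shift _
  have hpos' : ∀ j t, 0 < μ.real (shift (u j t) ⁻¹' cylinder (F j)) := fun j t => by
    rw [hsh]; exact hpos j
  have hmem := fun t => hμ.log_biInter_sub_sum_mem
    (A := fun j => shift (u j t) ⁻¹' cylinder (F j)) Finset.univ (fun j _ => hbox j t)
    (fun j _ => hpos' j t)
  have hIpos := fun t => hμ.biInter_pos
    (A := fun j => shift (u j t) ⁻¹' cylinder (F j)) Finset.univ (fun j _ => hbox j t)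
    (fun j _ => hpos' j t)
  simp only [hsh, Finset.mem_univ, Set.iInter_true] at hmem hIpos
  have hlim : Tendsto (fun t => ∑ p ∈ (Finset.univ : Finset ι).offDiag,
      logDep μ (shift (u p.1 t) ⁻¹' cylinder (F p.1)) (shift (u p.2 t) ⁻¹' cylinder (F p.2))) l
      (𝓝 (∑ p ∈ (Finset.univ : Finset ι).offDiag, 0)) := by
    refine tendsto_finsetSum _ fun p hp => ?_
    rcases lt_or_gt_of_ne (Finset.mem_offDiag.1 hp).2.2 with h | h
    · exact tendsto_logDep_cylinder hμ hinv hdep (hu _ _ h) (hpos _) (hpos _)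
    · simp only [logDep_comm μ (shift (u p.1 _) ⁻¹' _)]
      exact tendsto_logDep_cylinder hμ hinv hdep (hu _ _ h) (hpos _) (hpos _)
  rw [Finset.sum_const_zero] at hlim
  have hlog := squeeze_zero (fun t => (hmem t).1) (fun t => (hmem t).2) hlim
  have hexp := (hlog.add_const (∑ j, Real.log (μ.real (cylinder (F j))))).rexp
  rw [zero_add, ← Real.log_prod (fun j _ => (hpos j).ne'),
    Real.exp_log (Finset.prod_pos fun j _ => hpos j)] at hexp
  refine hexp.congr fun t => ?_
  rw [sub_add_cancel, Real.exp_log (hIpos t)]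

end Stationary

/-! ### Transfer between the process and its law. -/

section Law

theorem path_eq_shift_comp {Ω : Type*} (X : ℤ → Ω → ℝ) (t : ℤ) :
    path X t = shift t ∘ path X 0 := by
  ext ω s; simp [path, shift]

variable {Ω : Type*} [MeasurableSpace Ω] {P : Measure Ω} {X : ℤ → Ω → ℝ}

theorem measurable_path (hX : ∀ t, Measurable (X t)) (t : ℤ) : Measurable (path X t) :=
  measurable_pi_lambda _ fun _ => hX _

theorem IsStationary.measurePreserving_shift (hX : ∀ t, Measurable (X t))
    (h : IsStationary X P) (u : ℤ) :
    MeasurePreserving (shift u) (P.map (path X 0)) (P.map (path X 0)) := by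
  refine ⟨measurable_shift u, ?_⟩
  rw [Measure.map_map (measurable_shift u) (measurable_path hX 0), ← path_eq_shift_comp, h u]

theorem tau_eq_logDep (hX : ∀ t, Measurable (X t)) (a : ℝ) (t : ℤ) :
    tau X P a t = logDep (P.map (path X 0)) {x | x 0 ≤ a} {x | x t ≤ a} := by
  have hm := measurable_path hX 0
  rw [logDep, map_measureReal_apply hm ((isMaxBox_le 0 a).inter (isMaxBox_le t a)).1,
    map_measureReal_apply hm (isMaxBox_le 0 a).1, map_measureReal_apply hm (isMaxBox_le t a).1]
  simp [tau, path, Set.preimage, Set.ofPred_and]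

theorem lowerEndpoint_lt_of_real_pos [IsProbabilityMeasure P] {b : ℝ}
    (h : 0 < P.real {ω | X 0 ω < b}) :
    lowerEndpoint X P < b := by
  by_contra! hb
  refine h.ne' ((measureReal_eq_zero_iff).2 ?_)
  have := ae_essInf_le (μ := P) (f := fun ω => (X 0 ω : EReal))
  have h2 : ∀ᵐ ω ∂P, ¬ X 0 ω < b := this.mono fun ω hω => by
    rw [not_lt, ← EReal.coe_le_coe_iff]
    exact hb.trans hω
  simpa [ae_iff] using h2

theorem real_pos_of_lowerEndpoint_lt [IsProbabilityMeasure P] {a : ℝ} (h : lowerEndpoint X P < a) :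
    0 < P.real {ω | X 0 ω ≤ a} := by
  refine measureReal_nonneg.lt_of_ne fun h0 => h.not_ge ?_
  have h1 : ∀ᵐ ω ∂P, ¬ X 0 ω ≤ a := by
    simpa [ae_iff] using (measureReal_eq_zero_iff).1 h0.symm
  exact le_essInf_of_ae_le _ (h1.mono fun ω hω => EReal.coe_le_coe_iff.2 (not_le.1 hω).le)

theorem IsMixingOfAllOrders.isMixing (h : IsMixingOfAllOrders X P) : IsMixing X P := by
  intro A B hA hB
  have h1 := h 1 le_rfl ![A, B] (fun j => by fin_cases j <;> assumption)
  have h2 : Tendsto (fun (t : ℤ) (_ : Fin 1) => t) atTop (Filter.pi fun _ => atTop) :=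
    tendsto_pi.2 fun _ => tendsto_id
  have h3 := h1.comp h2
  rw [Fin.prod_univ_two] at h3
  refine h3.congr fun t => ?_
  simp only [Function.comp_apply]
  congr 1
  ext ω
  simp [Fin.forall_fin_two, Finset.filter_singleton]

theorem IsMixing.tendsto_tau [IsProbabilityMeasure P] (h : IsMixing X P)
    (hX : ∀ t, Measurable (X t))
    (hstat : IsStationary X P) {a : ℝ} (ha : lowerEndpoint X P < a) :
    Tendsto (fun t : ℤ => tau X P a t) atTop (𝓝 0) := by
  have hp := real_pos_of_lowerEndpoint_lt ha
  have hm := (isMaxBox_le 0 a).1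
  have h1 := (h _ _ hm hm).log (by simpa [path] using (mul_pos hp hp).ne')
  have h2 : ∀ t, P.real {ω | X t ω ≤ a} = P.real {ω | X 0 ω ≤ a} := fun t => by
    have := congrArg (fun μ => μ.real {x | x 0 ≤ a}) (hstat t)
    simp only [map_measureReal_apply (measurable_path hX _) hm] at this
    simpa [path] using this
  simp only [path, Set.preimage, Set.mem_ofPred_eq, zero_add, ← Set.ofPred_and] at h1
  rw [Real.log_mul hp.ne' hp.ne'] at h1
  have h3 := (h1.sub_const (Real.log (P.real {ω | X 0 ω ≤ a}))).sub_const
    (Real.log (P.real {ω | X 0 ω ≤ a}))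
  simp only [tau, h2]
  simpa using h3

theorem isMixingOfAllOrders_of_tendsto_tau [IsProbabilityMeasure P] (hX : ∀ t, Measurable (X t))
    (hstat : IsStationary X P) (hmax : IsMaxInfinitelyDivisible X P)
    (h : ∀ a : ℝ, lowerEndpoint X P < a → Tendsto (fun t : ℤ => tau X P a t) atTop (𝓝 0)) :
    IsMixingOfAllOrders X P := by
  intro r _ A hA
  have hm := measurable_path hX 0
  have : IsProbabilityMeasure (P.map (path X 0)) := Measure.isProbabilityMeasure_map hm.aemeasurable
  have hinv := hstat.measurePreserving_shift hX
  have hdep : ∀ b, 0 < (P.map (path X 0)).real {x | x 0 < b} →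
      Tendsto (fun t : ℤ => logDep (P.map (path X 0)) {x | x 0 ≤ b} {x | x t ≤ b}) atTop (𝓝 0) := by
    intro b hb
    rw [map_measureReal_apply hm (isMaxBox_lt 0 b).1] at hb
    refine (h b (lowerEndpoint_lt_of_real_pos ?_)).congr fun t => tau_eq_logDep hX b t
    simpa [path] using hb
  -- Once all `t i` are nonnegative, the gap between the two partial sums is at least its summand
  -- with index `j`.
  have hu : ∀ j k : Fin (r + 1), j < k → Tendsto (fun t : Fin r → ℤ =>
      (∑ i : Fin r with i.castSucc < k, t i) - ∑ i : Fin r with i.castSucc < j, t i)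
      (Filter.pi fun _ => atTop) atTop := by
    intro j k hjk
    obtain ⟨i, rfl⟩ : ∃ i : Fin r, i.castSucc = j :=
      ⟨j.castLT (by omega), by simp⟩
    refine tendsto_atTop_mono' _ ?_ (tendsto_eval_pi (fun _ : Fin r => (atTop : Filter ℤ)) i)
    have hnn : ∀ᶠ t : Fin r → ℤ in Filter.pi fun _ => atTop, ∀ i, 0 ≤ t i :=
      eventually_all.2 fun i => (tendsto_eval_pi (fun _ : Fin r => (atTop : Filter ℤ)) i).eventually
        (eventually_ge_atTop 0)
    filter_upwards [hnn] with t ht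
    rw [← Finset.sum_sdiff_eq_sub]
    · exact Finset.single_le_sum (f := t) (fun i _ => ht i) (by simp [hjk])
    · intro m hm
      simp only [Finset.mem_filter, Finset.mem_univ, true_and] at hm ⊢
      exact hm.trans hjk
  have key := tendsto_real_iInter_shift_of_piSystem hinv
    (fun (j : Fin (r + 1)) (t : Fin r → ℤ) => ∑ i : Fin r with i.castSucc < j, t i)
    pi_eq_generateFrom_range_cylinder isPiSystem_range_cylinder univ_mem_range_cylinder
    (fun A hA => by
      choose F hF using hA
      simp only [← hF]
      exact tendsto_real_iInter_shift_cylinder hmax.hasMaxRoots hinv hdep hu F) A hA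
  convert key using 2 with t
  · rw [map_measureReal_apply hm (MeasurableSet.iInter fun j => measurable_shift _ (hA j)),
      Set.preimage_iInter]
    simp only [← Set.preimage_comp, ← path_eq_shift_comp]
  · exact Finset.prod_congr rfl fun j _ => (map_measureReal_apply hm (hA j)).symm

end Law

end MaxID

theorem theorem1 {Ω : Type*} [MeasurableSpace Ω] (P : Measure Ω) [IsProbabilityMeasure P]
    (X : ℤ → Ω → ℝ) (hX : ∀ t, Measurable (X t))
    (hstat : MaxID.IsStationary X P) (hmax : MaxID.IsMaxInfinitelyDivisible X P) :
    List.TFAE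
      [MaxID.IsMixing X P,
       MaxID.IsMixingOfAllOrders X P,
       ∀ a : ℝ, MaxID.lowerEndpoint X P < (a : EReal) →
         Tendsto (fun t : ℤ => MaxID.tau X P a t) atTop (𝓝 0)] := by
  tfae_have 2 → 1 := fun h => h.isMixing
  tfae_have 1 → 3 := fun h a ha => h.tendsto_tau hX hstat ha
  tfae_have 3 → 2 := MaxID.isMixingOfAllOrders_of_tendsto_tau hX hstat hmax
  tfae_finish
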